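/- Let $[0,1]$ carry Lebesgue measure. A graphon is a measurable symmetric function $W:[0,1]^2\to[0,1]$; for a finite graph $H$ put $$t_H(W)=\int_{[0,1]^{V(H)}}\prod_{uv\in E(H)}W(x_u,x_v)\prod_{v\in V(H)}dx_v,\qquad m_H(W)=t_H(W)+t_H(1-W).$$ Let $M(H;n)$ be the minimum, over all 2-edge-colourings of $K_n$, of the number of labelled monochromatic copies of $H$. With $v=|V(H)|$, the graph $H$ is called common if $$\lim_{n\to\infty}\frac{M(H;n)}{n(n-1)\cdots(n-v+1)}=2^{1-e(H)}.$$ Let $H_3$ be the 5-vertex graph obtained from the 5-cycle $v_0v_1v_2v_3v_4$ by adding the chord $v_1v_4$ (so $e(H_3)=6$), and let $H_4$ be the 5-vertex graph obtained from $K_4$ by subdividing one edge once (so $e(H_4)=7$). Then $H_3$ and $H_4$ are common. Moreover, for every graphon $W$, $$m_{H_3}(W)\ge 2^{-5}\qquad\text{and}\qquad m_{H_4}(W)\ge 2^{-6}.$$ -/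

import Mathlib

open Filter Topology MeasureTheory

/-- A graphon: a measurable symmetric function `[0,1]² → [0,1]`. -/
structure Graphon where
  toFun : unitInterval → unitInterval → ℝ
  measurable_toFun : Measurable (Function.uncurry toFun)
  symm : ∀ x y, toFun x y = toFun y x
  nonneg : ∀ x y, 0 ≤ toFun x y
  le_one : ∀ x y, toFun x y ≤ 1

namespace Graphon

/-- The graphon `1 - W`. -/
def compl (W : Graphon) : Graphon where
  toFun x y := 1 - W.toFun x y
  measurable_toFun := W.measurable_toFun.const_sub 1
  symm x y := by rw [W.symm]
  nonneg x y := sub_nonneg.2 (W.le_one x y)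
  le_one x y := sub_le_self _ (W.nonneg x y)

/-- The homomorphism density `t_H(W)`: the expectation of `∏_{uv ∈ E(H)} W(x_u, x_v)`, where the
points `x_v`, for `v ∈ V(H)`, are independent and uniform in `[0,1]`. -/
noncomputable def homDensity {V : Type*} [Fintype V] (H : SimpleGraph V) [Fintype H.edgeSet]
    (W : Graphon) : ℝ :=
  ∫ x : V → unitInterval,
    ∏ e ∈ H.edgeFinset,
      Sym2.lift ⟨fun u v => W.toFun (x u) (x v), fun u v => W.symm (x u) (x v)⟩ e

/-- `m_H(W) = t_H(W) + t_H(1 - W)`. -/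
noncomputable def monoDensity {V : Type*} [Fintype V] (H : SimpleGraph V) [Fintype H.edgeSet]
    (W : Graphon) : ℝ :=
  homDensity H W + homDensity H W.compl

end Graphon

namespace SimpleGraph

/-- The number of labelled monochromatic copies of `H` (i.e. of injective vertex maps sending all
edges of `H` to edges of one colour) in a 2-edge-colouring `c` of the complete graph `K_n`. -/
noncomputable def monoCopyCount {V : Type*} [Fintype V] (H : SimpleGraph V) {n : ℕ}
    (c : TopEdgeLabeling (Fin n) (Fin 2)) : ℕ :=
  ∑ i : Fin 2, (c.labelGraph i).labelledCopyCount H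

/-- The Ramsey multiplicity `M(H; n)`: the minimum number of labelled monochromatic copies of `H`
over all 2-edge-colourings of `K_n`. -/
noncomputable def ramseyMultiplicity {V : Type*} [Fintype V] (H : SimpleGraph V) (n : ℕ) : ℕ :=
  ⨅ c : TopEdgeLabeling (Fin n) (Fin 2), monoCopyCount H c

/-- `H` is common if its Ramsey multiplicity constant
`C(H) = lim_{n → ∞} M(H; n) / (n (n - 1) ⋯ (n - |V(H)| + 1))` is `2 ^ (1 - e(H))`. -/
def IsCommon {V : Type*} [Fintype V] (H : SimpleGraph V) [Fintype H.edgeSet] : Prop :=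
  Tendsto
    (fun n : ℕ => (ramseyMultiplicity H n : ℝ) / (n.descFactorial (Fintype.card V) : ℝ))
    atTop (𝓝 ((2 : ℝ) ^ (1 - (H.edgeFinset.card : ℤ))))

end SimpleGraph

/-- The graph `H₃`: the 5-cycle `0 1 2 3 4` with the chord `14` (the "house"). -/
def graphH3 : SimpleGraph (Fin 5) :=
  SimpleGraph.fromRel fun u v =>
    (u, v) ∈ [((0 : Fin 5), (1 : Fin 5)), (1, 2), (2, 3), (3, 4), (4, 0), (1, 4)]

/-- The graph `H₄`: the complete graph on `0 1 2 3` with the edge `03` subdivided by the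
vertex `4`. -/
def graphH4 : SimpleGraph (Fin 5) :=
  SimpleGraph.fromRel fun u v =>
    (u, v) ∈ [((0 : Fin 5), (1 : Fin 5)), (0, 2), (1, 2), (1, 3), (2, 3), (0, 4), (4, 3)]

instance : DecidableRel graphH3.Adj := by
  unfold graphH3; infer_instance

instance : DecidableRel graphH4.Adj := by
  unfold graphH4; infer_instance

/-!
Write `W = (1 + U) / 2` with `U` symmetric and `|U| ≤ 1`. Then
`2 ^ (e(H) - 1) (t_H(W) + t_H(1 - W))` is the sum of `t_F(U)` over the subgraphs `F` of `H` with an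
even number of edges, and the claim is that the nonempty `F` contribute a nonnegative amount. Both
inequalities are proved for kernels on a finite set with uniform weights, where integrals are finite
averages. Let `d` be the degree function of `U`, `K(a,b)` the codegree, `e` and `p` the averages of
`d` and `d²`, `D(a) = 𝔼_z U(a,z) d(z)` and `q` the average of `D²`.

* House (`house_core`). With the chord `ab` integrated last, the sum is a combination of `p`, `e²`,
  `q` and `𝔼 d² D`, plus `𝔼 K²` and `𝔼 U K Z`, where `Z = d(a) + d(b) + e + N` and `N(a,b)` is the
  density of 3-edge walks from `a` to `b`. Now `K² + 2 U K Z + Z² ≥ 0` as `|U| ≤ 1`, and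
  `𝔼 N² ≤ 𝔼 K²` (`expect_sq_pathThree_le`), so `K²` pays for `N²`, and the terms in `p` pay for
  the rest.
* Subdivided `K₄` (`subdividedK4_core`). The graph is `K_{2,3}` plus an edge `ab` in its part
  `{a, b, c}` of size three, so the sum is the average of `G₀² + G₁² + 2 U(a,b) G₀ G₁`, with
  `G₀ = 1 + K(a,b) + K(a,c) + K(b,c)`, `G₁ = d(a) + d(b) + d(c) + T(a,b,c)` and `T` the triple
  codegree. Discarding the nonnegative form in `K(a,c) + K(b,c)` and `T` leaves `𝔼 K²`, terms
  bounded by `p`, and `2 𝔼 U K Z` where `Z = 3/2 (d(a) + d(b)) + e + R` is linear in `d`, with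
  `R = 𝔼_c T` and `R² ≤ p`. So again `K² + 2 U K Z ≥ -Z²` suffices.

The finite inequality passes to a graphon by sampling `n` points (`FinitelyCommon.le_monoDensity`),
and to colourings of `K_n` by taking for `W` the indicator of one colour; in both cases vertex maps
that are not injective are negligible as `n → ∞`. The matching upper bound on the Ramsey
multiplicity is the average over all colourings (`ramseyMultiplicity_le`).
-/

namespace CommonGraph

open Finset
open scoped BigOperators

/-! ### Averages of kernels on a finite set -/

section
variable {ι : Type*} [Fintype ι]

/-- The degree function `d(a) = 𝔼_z U(a, z)` of a kernel on a finite set with uniform weights. -/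
noncomputable def normDegree (U : ι → ι → ℝ) (a : ι) : ℝ := 𝔼 z, U a z

/-- The density of walks with two edges starting at `a`. -/
noncomputable def walkTwo (U : ι → ι → ℝ) (a : ι) : ℝ := 𝔼 z, U a z * normDegree U z

/-- The density of walks with three edges starting at `a`. -/
noncomputable def walkThree (U : ι → ι → ℝ) (a : ι) : ℝ := 𝔼 z, U a z * walkTwo U z

/-- The density of common neighbours of `a` and `b`. -/
noncomputable def normCodegree (U : ι → ι → ℝ) (a b : ι) : ℝ := 𝔼 z, U a z * U b z

/-- The density of walks with three edges from `a` to `b`, for a symmetric kernel. -/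
noncomputable def pathThree (U : ι → ι → ℝ) (a b : ι) : ℝ := 𝔼 z, U a z * normCodegree U z b

/-- The density of common neighbours of `a`, `b` and `c`. -/
noncomputable def tripleCodegree (U : ι → ι → ℝ) (a b c : ι) : ℝ := 𝔼 z, U a z * U b z * U c z

/-- The density of common neighbours of `a` and `b` carrying a pendant edge. -/
noncomputable def pendantCodegree (U : ι → ι → ℝ) (a b : ι) : ℝ :=
  𝔼 z, U a z * U b z * normDegree U z

variable {U : ι → ι → ℝ}

lemma normCodegree_comm (a b : ι) : normCodegree U a b = normCodegree U b a := by
  simp only [normCodegree, mul_comm]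

lemma sq_expect_mul_le [Nonempty ι] (f g : ι → ℝ) :
    (𝔼 i, f i * g i) ^ 2 ≤ (𝔼 i, f i ^ 2) * 𝔼 i, g i ^ 2 := by
  have hc : (0 : ℝ) < Fintype.card ι := by positivity
  simp only [Fintype.expect_eq_sum_div_card]
  have := Finset.sum_mul_sq_le_sq_mul_sq univ f g
  rw [div_pow, div_mul_div_comm, ← sq]
  gcongr

/-- The integral operator of a symmetric kernel is self-adjoint. -/
lemma expect_symm_mul (hU : ∀ x y, U x y = U y x) (g h : ι → ℝ) :
    𝔼 a, h a * 𝔼 z, U a z * g z = 𝔼 a, g a * 𝔼 z, U a z * h z := by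
  simp only [mul_expect]
  rw [expect_comm]
  refine expect_congr rfl fun a _ => expect_congr rfl fun b _ => ?_
  rw [hU b a]; ring

lemma abs_expect_le [Nonempty ι] {f g : ι → ℝ} (h : ∀ i, |f i| ≤ g i) :
    |𝔼 i, f i| ≤ 𝔼 i, g i :=
  (Finset.abs_expect_le _ _).trans (expect_le_expect fun i _ => h i)

lemma expect_normDegree_mul (hU : ∀ x y, U x y = U y x) (g : ι → ℝ) :
    𝔼 a, normDegree U a * g a = 𝔼 a, 𝔼 z, U a z * g z := by
  have := expect_symm_mul hU g fun _ => 1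
  simp only [one_mul, mul_one] at this
  rw [this]
  exact expect_congr rfl fun a _ => mul_comm _ _

lemma expect_walkTwo_mul (hU : ∀ x y, U x y = U y x) (g : ι → ℝ) :
    𝔼 a, walkTwo U a * g a = 𝔼 a, normDegree U a * 𝔼 z, U a z * g z := by
  rw [expect_symm_mul hU g]
  exact expect_congr rfl fun a _ => mul_comm _ _

lemma expect_walkTwo (hU : ∀ x y, U x y = U y x) :
    𝔼 a, walkTwo U a = 𝔼 a, normDegree U a ^ 2 := by
  have := expect_normDegree_mul hU (normDegree U)
  simp only [sq, this, walkTwo]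

lemma expect_walkThree (hU : ∀ x y, U x y = U y x) :
    𝔼 a, walkThree U a = 𝔼 a, normDegree U a * walkTwo U a := by
  simp only [expect_normDegree_mul hU (walkTwo U), walkThree]

lemma expect_normDegree_mul_walkThree (hU : ∀ x y, U x y = U y x) :
    𝔼 a, normDegree U a * walkThree U a = 𝔼 a, walkTwo U a ^ 2 := by
  have := expect_walkTwo_mul hU (walkTwo U)
  simp only [sq, this, walkThree]

lemma expect_mul_normCodegree (hU : ∀ x y, U x y = U y x) (a : ι) (h : ι → ℝ) :
    𝔼 b, h b * normCodegree U a b = 𝔼 z, U a z * 𝔼 b, U z b * h b := by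
  simp only [normCodegree, mul_expect]
  rw [expect_comm]
  refine expect_congr rfl fun z _ => expect_congr rfl fun b _ => ?_
  rw [hU b z]; ring

lemma expect_normCodegree (hU : ∀ x y, U x y = U y x) (a : ι) :
    𝔼 b, normCodegree U a b = walkTwo U a := by
  have := expect_mul_normCodegree hU a fun _ => 1
  simp only [one_mul, mul_one] at this
  exact this

lemma expect_normDegree_mul_normCodegree (hU : ∀ x y, U x y = U y x) (a : ι) :
    𝔼 b, normDegree U b * normCodegree U a b = walkThree U a :=
  expect_mul_normCodegree hU a _

lemma expect_mul_tripleCodegree (hU : ∀ x y, U x y = U y x) (a b : ι) (h : ι → ℝ) :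
    𝔼 c, h c * tripleCodegree U a b c = 𝔼 z, U a z * U b z * 𝔼 c, U z c * h c := by
  simp only [tripleCodegree, mul_expect]
  rw [expect_comm]
  refine expect_congr rfl fun z _ => expect_congr rfl fun c _ => ?_
  rw [hU c z]; ring

lemma expect_tripleCodegree (hU : ∀ x y, U x y = U y x) (a b : ι) :
    𝔼 c, tripleCodegree U a b c = pendantCodegree U a b := by
  have := expect_mul_tripleCodegree hU a b fun _ => 1
  simp only [one_mul, mul_one] at this
  exact this

/-- Integrating a weighted codegree against a product of vertex functions, by first fixing the
common neighbour. -/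
lemma expect_expect_codegree (hU : ∀ x y, U x y = U y x) (w g h : ι → ℝ) :
    𝔼 a, 𝔼 b, g a * h b * 𝔼 z, U a z * U b z * w z
      = 𝔼 z, w z * (𝔼 a, U z a * g a) * 𝔼 b, U z b * h b := by
  simp only [mul_expect, expect_mul]
  rw [expect_comm]
  simp_rw [fun b => expect_comm univ univ fun a z => g a * h b * (U a z * U b z * w z)]
  rw [expect_comm]
  refine expect_congr rfl fun z _ => expect_congr rfl fun b _ => expect_congr rfl fun a _ => ?_
  rw [hU a z, hU b z]; ring

lemma expect_pathThree (hU : ∀ x y, U x y = U y x) :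
    𝔼 a, 𝔼 b, pathThree U a b = 𝔼 a, normDegree U a * walkTwo U a := by
  rw [← expect_walkThree hU]
  refine expect_congr rfl fun a _ => ?_
  simp only [pathThree, walkThree]
  rw [expect_comm]
  refine expect_congr rfl fun z _ => ?_
  rw [← mul_expect, expect_normCodegree hU]

lemma pathThree_comm (hU : ∀ x y, U x y = U y x) (a b : ι) : pathThree U a b = pathThree U b a := by
  simp only [pathThree, normCodegree, mul_expect]
  rw [expect_comm]
  refine expect_congr rfl fun x _ => expect_congr rfl fun y _ => ?_
  rw [hU x y]; ring

lemma expect_normDegree_mul_pathThree (hU : ∀ x y, U x y = U y x) :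
    𝔼 a, 𝔼 b, normDegree U a * pathThree U a b = 𝔼 a, walkTwo U a ^ 2 := by
  rw [← expect_normDegree_mul_walkThree hU]
  refine expect_congr rfl fun a _ => ?_
  rw [← mul_expect]
  congr 1
  simp only [pathThree, walkThree]
  rw [expect_comm]
  refine expect_congr rfl fun z _ => ?_
  rw [← mul_expect, expect_normCodegree hU]

/-- Both sides are the density of the 4-cycle. -/
lemma expect_mul_pathThree (hU : ∀ x y, U x y = U y x) :
    𝔼 a, 𝔼 b, U a b * pathThree U a b = 𝔼 a, 𝔼 b, normCodegree U a b ^ 2 := by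
  rw [expect_comm]
  simp only [pathThree, mul_expect]
  refine expect_congr rfl fun a _ => ?_
  rw [expect_comm]
  refine expect_congr rfl fun b _ => ?_
  rw [sq, ← normCodegree_comm, normCodegree, expect_mul]
  refine expect_congr rfl fun z _ => ?_
  rw [hU z a, hU z b]
  ring

/-- Composing with a kernel bounded by `1` does not increase the `L²` norm. -/
lemma expect_sq_pathThree_le [Nonempty ι] (h1 : ∀ x y, |U x y| ≤ 1) :
    𝔼 a, 𝔼 b, pathThree U a b ^ 2 ≤ 𝔼 a, 𝔼 b, normCodegree U a b ^ 2 := by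
  rw [expect_comm, expect_comm univ univ fun a b => normCodegree U a b ^ 2]
  refine expect_le_expect fun b _ => ?_
  rw [← expect_const univ_nonempty (𝔼 z, normCodegree U z b ^ 2) (ι := ι)]
  refine expect_le_expect fun a _ => (sq_expect_mul_le _ _).trans ?_
  refine mul_le_of_le_one_left (expect_nonneg fun _ _ => sq_nonneg _) ?_
  rw [← expect_const univ_nonempty (1 : ℝ) (ι := ι)]
  exact expect_le_expect fun z _ => (sq_le_one_iff_abs_le_one _).2 (h1 a z)

lemma sq_pendantCodegree_le [Nonempty ι] (h1 : ∀ x y, |U x y| ≤ 1) (a b : ι) :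
    pendantCodegree U a b ^ 2 ≤ 𝔼 z, normDegree U z ^ 2 := by
  refine (sq_expect_mul_le _ _).trans ?_
  refine mul_le_of_le_one_left (expect_nonneg fun _ _ => sq_nonneg _) ?_
  rw [← expect_const univ_nonempty (1 : ℝ) (ι := ι)]
  refine expect_le_expect fun z _ => (sq_le_one_iff_abs_le_one _).2 ?_
  rw [abs_mul]
  exact mul_le_one₀ (h1 a z) (abs_nonneg _) (h1 b z)

lemma abs_normDegree_le_one [Nonempty ι] (h1 : ∀ x y, |U x y| ≤ 1) (a : ι) :
    |normDegree U a| ≤ 1 := by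
  refine (abs_expect_le (h1 a)).trans_eq (expect_const univ_nonempty _)

lemma abs_walkTwo_le_one [Nonempty ι] (h1 : ∀ x y, |U x y| ≤ 1) (a : ι) :
    |walkTwo U a| ≤ 1 := by
  refine (abs_expect_le (g := fun _ => 1) fun z => ?_).trans_eq (expect_const univ_nonempty _)
  rw [abs_mul]
  exact mul_le_one₀ (h1 a z) (abs_nonneg _) (abs_normDegree_le_one h1 z)

/-- Both sides are the density of the triangle with a pendant edge. This lets the degree factor be
moved from the common neighbour to an end point. -/
lemma expect_mul_pendantCodegree (hU : ∀ x y, U x y = U y x) :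
    𝔼 a, 𝔼 b, U a b * pendantCodegree U a b
      = 𝔼 a, 𝔼 b, U a b * normCodegree U a b * normDegree U a := by
  simp only [pendantCodegree, normCodegree, mul_expect, expect_mul]
  simp_rw [fun a => expect_comm univ univ fun b z => U a b * (U a z * U b z * normDegree U z)]
  rw [expect_comm]
  refine expect_congr rfl fun z _ => expect_congr rfl fun b _ => expect_congr rfl fun a _ => ?_
  rw [hU z b, hU z a, hU b a]; ring

/-! ### Averages over pairs of vertices -/

lemma expect_expect_nonneg {f : ι → ι → ℝ} (h : ∀ a b, 0 ≤ f a b) : 0 ≤ 𝔼 a, 𝔼 b, f a b :=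
  expect_nonneg fun a _ => expect_nonneg fun b _ => h a b

lemma sq_expect_le [Nonempty ι] (f : ι → ℝ) : (𝔼 i, f i) ^ 2 ≤ 𝔼 i, f i ^ 2 := by
  have := sq_expect_mul_le f fun _ => 1
  simpa only [mul_one, one_pow, Fintype.expect_const] using this

lemma expect_expect_fst [Nonempty ι] (g : ι → ℝ) : 𝔼 a, 𝔼 _b : ι, g a = 𝔼 a, g a := by
  simp only [Fintype.expect_const]

lemma expect_expect_snd [Nonempty ι] (g : ι → ℝ) : 𝔼 _a : ι, 𝔼 b, g b = 𝔼 a, g a := by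
  simp only [Fintype.expect_const]

lemma expect_expect_mul (g h : ι → ℝ) : 𝔼 a, 𝔼 b, g a * h b = (𝔼 a, g a) * 𝔼 b, h b := by
  simp only [← expect_mul, ← mul_expect]

lemma expect_expect_mul_fst (F : ι → ι → ℝ) (g : ι → ℝ) :
    𝔼 a, 𝔼 b, F a b * g a = 𝔼 a, g a * 𝔼 b, F a b := by
  simp only [mul_expect, mul_comm]

lemma expect_expect_mul_snd {F : ι → ι → ℝ} (hF : ∀ x y, F x y = F y x) (g : ι → ℝ) :
    𝔼 a, 𝔼 b, F a b * g b = 𝔼 a, g a * 𝔼 b, F a b := by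
  rw [expect_comm, ← expect_expect_mul_fst]
  simp only [hF]

lemma expect_eq_normDegree (a : ι) : 𝔼 b, U a b = normDegree U a := rfl

/-- The completed square behind both inequalities: `k² + 2ukz + z² = (k + uz)² + (1 - u²)z²`. -/
lemma completed_square_nonneg {u : ℝ} (hu : |u| ≤ 1) (k z : ℝ) :
    0 ≤ k ^ 2 + 2 * (u * k * z) + z ^ 2 := by
  have hu2 : u ^ 2 ≤ 1 := (sq_le_one_iff_abs_le_one _).2 hu
  linarith [sq_nonneg (k + u * z), mul_nonneg (sub_nonneg.2 hu2) (sq_nonneg z)]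

lemma neg_sq_le_sq_mul (x : ℝ) {y : ℝ} (hy : |y| ≤ 1) : -x ^ 2 ≤ x ^ 2 * y := by
  nlinarith [(abs_le.1 hy).1, sq_nonneg x]

lemma neg_sq_le_sq_mul_add_sq {x : ℝ} (hx : |x| ≤ 1) (y : ℝ) :
    -x ^ 2 ≤ 4 * (x ^ 2 * y) + 4 * y ^ 2 := by
  have hx2 : x ^ 2 ≤ 1 := (sq_le_one_iff_abs_le_one _).2 hx
  linarith [sq_nonneg (x ^ 2 + 2 * y), mul_nonneg (sq_nonneg x) (sub_nonneg.2 hx2)]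

lemma mul_le_of_abs_le_of_abs_le_one {x y c : ℝ} (hx : |x| ≤ c) (hy : |y| ≤ 1) : x * y ≤ c := by
  calc x * y ≤ |x| * |y| := by rw [← abs_mul]; exact le_abs_self _
    _ ≤ |x| := mul_le_of_le_one_right (abs_nonneg _) hy
    _ ≤ c := hx

lemma expect_expect_normCodegree (hU : ∀ x y, U x y = U y x) :
    𝔼 a, 𝔼 b, normCodegree U a b
      = 𝔼 a, normDegree U a ^ 2 := by
  simp only [expect_normCodegree hU, expect_walkTwo hU]

lemma expect_expect_normDegree_mul_normDegree (U : ι → ι → ℝ) :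
    𝔼 a, 𝔼 b, normDegree U a * normDegree U b
      = (𝔼 z, normDegree U z) ^ 2 := by
  rw [expect_expect_mul, sq]

lemma expect_expect_normCodegree_mul_walkTwo_fst (hU : ∀ x y, U x y = U y x) :
    𝔼 a, 𝔼 b, normCodegree U a b * walkTwo U a
      = 𝔼 a, walkTwo U a ^ 2 := by
  rw [expect_expect_mul_fst]; simp only [expect_normCodegree hU, sq]

lemma expect_expect_normCodegree_mul_walkTwo_snd (hU : ∀ x y, U x y = U y x) :
    𝔼 a, 𝔼 b, normCodegree U a b * walkTwo U b
      = 𝔼 a, walkTwo U a ^ 2 := by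
  rw [expect_expect_mul_snd normCodegree_comm]; simp only [expect_normCodegree hU, sq]

lemma expect_expect_normDegree_fst_mul (U : ι → ι → ℝ) [Nonempty ι] :
    𝔼 a, 𝔼 _b : ι, normDegree U a * (𝔼 z, normDegree U z)
      = (𝔼 z, normDegree U z) ^ 2 := by
  rw [expect_expect_fst, ← expect_mul, sq]

lemma expect_expect_normDegree_snd_mul (U : ι → ι → ℝ) [Nonempty ι] :
    𝔼 _a : ι, 𝔼 b, normDegree U b * (𝔼 z, normDegree U z)
      = (𝔼 z, normDegree U z) ^ 2 := by
  rw [expect_expect_snd, ← expect_mul, sq]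

lemma expect_expect_mul_normDegree_fst (U : ι → ι → ℝ) :
    𝔼 a, 𝔼 b, U a b * normDegree U a
      = 𝔼 a, normDegree U a ^ 2 := by
  rw [expect_expect_mul_fst]; simp only [expect_eq_normDegree, sq]

lemma expect_expect_mul_normDegree_snd (hU : ∀ x y, U x y = U y x) :
    𝔼 a, 𝔼 b, U a b * normDegree U b
      = 𝔼 a, normDegree U a ^ 2 := by
  rw [expect_expect_mul_snd hU]; simp only [expect_eq_normDegree, sq]

lemma expect_expect_mul_expect_normDegree (U : ι → ι → ℝ) :
    𝔼 a, 𝔼 b, U a b * (𝔼 z, normDegree U z)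
      = (𝔼 z, normDegree U z) ^ 2 := by
  simp only [← expect_mul, expect_eq_normDegree]; rw [sq]

lemma expect_expect_mul_normDegree_mul_walkTwo_fst (U : ι → ι → ℝ) :
    𝔼 a, 𝔼 b, U a b * (normDegree U a * walkTwo U a)
      = 𝔼 a, normDegree U a ^ 2 * walkTwo U a := by
  rw [expect_expect_mul_fst U fun a => normDegree U a * walkTwo U a]
  exact expect_congr rfl fun a _ => by rw [expect_eq_normDegree]; ring

lemma expect_expect_mul_normDegree_mul_walkTwo_snd (hU : ∀ x y, U x y = U y x) :
    𝔼 a, 𝔼 b, U a b * (normDegree U b * walkTwo U b)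
      = 𝔼 a, normDegree U a ^ 2 * walkTwo U a := by
  rw [expect_expect_mul_snd hU fun a => normDegree U a * walkTwo U a]
  exact expect_congr rfl fun a _ => by rw [expect_eq_normDegree]; ring

lemma expect_expect_normDegree_mul_mul_walkTwo (hU : ∀ x y, U x y = U y x) :
    𝔼 a, 𝔼 b, normDegree U a * (U a b * walkTwo U b)
      = 𝔼 a, walkTwo U a ^ 2 := by
  simp only [← mul_expect]; exact expect_normDegree_mul_walkThree hU

lemma expect_expect_normDegree_snd_mul_mul_walkTwo (hU : ∀ x y, U x y = U y x) :
    𝔼 a, 𝔼 b, normDegree U b * (U a b * walkTwo U a)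
      = 𝔼 a, walkTwo U a ^ 2 := by
  rw [expect_comm, ← expect_expect_normDegree_mul_mul_walkTwo hU]; simp only [hU]

/-! ### The inequality for the house -/

/-- The averaged polynomial is `2⁵ (t(W) + t(1 - W))` for the house and `W = (1 + U) / 2`, with the
chord `ab` integrated last. After expansion the only terms without a sign are bounded by completing
the square in the codegree `K`: `K² / 2 + U K Z ≥ -Z² / 2`, where the path density in `Z` is paid
for by the other half of `K²`. -/
lemma house_core [Nonempty ι] (hU : ∀ x y, U x y = U y x) (h1 : ∀ x y, |U x y| ≤ 1) :
    1 ≤ 𝔼 a, 𝔼 b,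
      ((1 + normCodegree U a b) * (1 + walkTwo U a + walkTwo U b + normDegree U a * normDegree U b)
      + (normDegree U a + normDegree U b) *
        (normDegree U a + normDegree U b + (𝔼 z, normDegree U z) + pathThree U a b)
      + U a b * ((1 + normCodegree U a b) *
        (normDegree U a + normDegree U b + (𝔼 z, normDegree U z) + pathThree U a b)
      + (normDegree U a + normDegree U b) *
        (1 + walkTwo U a + walkTwo U b + normDegree U a * normDegree U b))) := by
  set d := normDegree U
  set D := walkTwo U
  set K := normCodegree U
  set e := 𝔼 z, d z
  set p := 𝔼 a, d a ^ 2 with hp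
  set q := 𝔼 a, D a ^ 2 with hq
  set f := 𝔼 a, d a ^ 2 * D a with hf
  set k := 𝔼 a, 𝔼 b, K a b ^ 2 with hk
  have hUD : ∀ a, 𝔼 b, U a b * d b = D a := fun _ => rfl
  have hDp : 𝔼 a, D a = p := expect_walkTwo hU
  have hdQ : 𝔼 a, d a * walkThree U a = q := expect_normDegree_mul_walkThree hU
  have i1 : 𝔼 _a : ι, 𝔼 _b : ι, (1 : ℝ) = 1 := by simp only [Fintype.expect_const]
  have iK : 𝔼 a, 𝔼 b, K a b = p :=
    expect_expect_normCodegree hU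
  have iDa : 𝔼 a, 𝔼 _b : ι, D a = p := by rw [expect_expect_fst, hDp]
  have iDb : 𝔼 _a : ι, 𝔼 b, D b = p := by rw [expect_expect_snd, hDp]
  have idd : 𝔼 a, 𝔼 b, d a * d b = e ^ 2 :=
    expect_expect_normDegree_mul_normDegree U
  have iKDa : 𝔼 a, 𝔼 b, K a b * D a = q :=
    expect_expect_normCodegree_mul_walkTwo_fst hU
  have iKDb : 𝔼 a, 𝔼 b, K a b * D b = q :=
    expect_expect_normCodegree_mul_walkTwo_snd hU
  have id2a : 𝔼 a, 𝔼 _b : ι, d a ^ 2 = p := expect_expect_fst fun a => d a ^ 2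
  have id2b : 𝔼 _a : ι, 𝔼 b, d b ^ 2 = p := expect_expect_snd fun a => d a ^ 2
  have ida : 𝔼 a, 𝔼 _b : ι, d a * e = e ^ 2 :=
    expect_expect_normDegree_fst_mul U
  have idb : 𝔼 _a : ι, 𝔼 b, d b * e = e ^ 2 :=
    expect_expect_normDegree_snd_mul U
  have ie2 : 𝔼 _a : ι, 𝔼 _b : ι, e ^ 2 = e ^ 2 := by simp only [Fintype.expect_const]
  have iUda : 𝔼 a, 𝔼 b, U a b * d a = p :=
    expect_expect_mul_normDegree_fst U
  have iUdb : 𝔼 a, 𝔼 b, U a b * d b = p :=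
    expect_expect_mul_normDegree_snd hU
  have iUe : 𝔼 a, 𝔼 b, U a b * e = e ^ 2 :=
    expect_expect_mul_expect_normDegree U
  have iUdDa : 𝔼 a, 𝔼 b, U a b * (d a * D a) = f :=
    expect_expect_mul_normDegree_mul_walkTwo_fst U
  have iUdDb : 𝔼 a, 𝔼 b, U a b * (d b * D b) = f :=
    expect_expect_mul_normDegree_mul_walkTwo_snd hU
  have iUdaDb : 𝔼 a, 𝔼 b, d a * (U a b * D b) = q :=
    expect_expect_normDegree_mul_mul_walkTwo hU
  have iUdbDa : 𝔼 a, 𝔼 b, d b * (U a b * D a) = q :=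
    expect_expect_normDegree_snd_mul_mul_walkTwo hU
  set N := pathThree U
  set r := 𝔼 a, d a * D a with hr
  have hNs : ∀ a b, N a b = N b a := pathThree_comm hU
  have iKdd : 𝔼 a, 𝔼 b, d a * (d b * K a b) = q := by
    simp only [← mul_expect]
    rw [← hdQ]
    exact expect_congr rfl fun a _ => by rw [expect_normDegree_mul_normCodegree hU a]
  have idNa : 𝔼 a, 𝔼 b, d a * N a b = q := expect_normDegree_mul_pathThree hU
  have idNb : 𝔼 a, 𝔼 b, d b * N a b = q := by
    rw [expect_comm, ← idNa]; simp only [hNs]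
  have iUN : 𝔼 a, 𝔼 b, U a b * N a b = k := expect_mul_pathThree hU
  have iUdda : 𝔼 a, 𝔼 b, d a ^ 2 * (U a b * d b) = f := by
    simp only [← mul_expect, hUD]; rfl
  have iUddb : 𝔼 a, 𝔼 b, d b ^ 2 * (U a b * d a) = f := by
    rw [expect_comm, ← iUdda]; simp only [hU]
  have iN : 𝔼 a, 𝔼 b, N a b * e = r * e := by
    simp only [← expect_mul]; rw [expect_pathThree hU]
  have iN2 : 𝔼 a, 𝔼 b, N a b ^ 2 ≤ k := expect_sq_pathThree_le h1
  -- `p`, `q`, `r` and `k` are the densities of the paths with two, four and three edges and of the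
  -- 4-cycle, `f` is that of the claw with one edge subdivided
  have expand : 𝔼 a, 𝔼 b, ((1 + K a b) * (1 + D a + D b + d a * d b)
      + (d a + d b) * (d a + d b + e + N a b)
      + U a b * ((1 + K a b) * (d a + d b + e + N a b)
      + (d a + d b) * (1 + D a + D b + d a * d b)))
      = (𝔼 a : ι, 𝔼 b : ι, (1 : ℝ)) + (𝔼 a : ι, 𝔼 b : ι, K a b) + (𝔼 a : ι, 𝔼 b : ι, D a)
        + (𝔼 a : ι, 𝔼 b : ι, D b) + 3 * (𝔼 a : ι, 𝔼 b : ι, d a * d b)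
        + (𝔼 a : ι, 𝔼 b : ι, K a b * D a) + (𝔼 a : ι, 𝔼 b : ι, K a b * D b)
        + (𝔼 a : ι, 𝔼 b : ι, d a * (d b * K a b)) + (𝔼 a : ι, 𝔼 b : ι, d a ^ 2)
        + (𝔼 a : ι, 𝔼 b : ι, d b ^ 2) + (𝔼 a : ι, 𝔼 b : ι, d a * e)
        + (𝔼 a : ι, 𝔼 b : ι, d b * e) + (𝔼 a : ι, 𝔼 b : ι, d a * N a b)
        + (𝔼 a : ι, 𝔼 b : ι, d b * N a b) + 2 * (𝔼 a : ι, 𝔼 b : ι, U a b * d a)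
        + 2 * (𝔼 a : ι, 𝔼 b : ι, U a b * d b) + (𝔼 a : ι, 𝔼 b : ι, U a b * e)
        + (𝔼 a : ι, 𝔼 b : ι, U a b * N a b)
        + (𝔼 a : ι, 𝔼 b : ι, U a b * K a b * (d a + d b + e + N a b))
        + (𝔼 a : ι, 𝔼 b : ι, U a b * (d a * D a)) + (𝔼 a : ι, 𝔼 b : ι, U a b * (d b * D b))
        + (𝔼 a : ι, 𝔼 b : ι, d a * (U a b * D b)) + (𝔼 a : ι, 𝔼 b : ι, d b * (U a b * D a))
        + (𝔼 a : ι, 𝔼 b : ι, d a ^ 2 * (U a b * d b))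
        + (𝔼 a : ι, 𝔼 b : ι, d b ^ 2 * (U a b * d a)) := by
    simp only [mul_expect, ← expect_add_distrib]
    exact expect_congr rfl fun a _ => expect_congr rfl fun b _ => by ring
  have expand_sq : 𝔼 a, 𝔼 b, (K a b ^ 2
      + 2 * (U a b * K a b * (d a + d b + e + N a b))
      + (d a + d b + e + N a b) ^ 2)
      = (𝔼 a : ι, 𝔼 b : ι, K a b ^ 2)
        + 2 * (𝔼 a : ι, 𝔼 b : ι, U a b * K a b * (d a + d b + e + N a b))
        + (𝔼 a : ι, 𝔼 b : ι, d a ^ 2) + (𝔼 a : ι, 𝔼 b : ι, d b ^ 2) + (𝔼 a : ι, 𝔼 b : ι, e ^ 2)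
        + (𝔼 a : ι, 𝔼 b : ι, N a b ^ 2) + 2 * (𝔼 a : ι, 𝔼 b : ι, d a * d b)
        + 2 * (𝔼 a : ι, 𝔼 b : ι, d a * e) + 2 * (𝔼 a : ι, 𝔼 b : ι, d b * e)
        + 2 * (𝔼 a : ι, 𝔼 b : ι, d a * N a b) + 2 * (𝔼 a : ι, 𝔼 b : ι, d b * N a b)
        + 2 * (𝔼 a : ι, 𝔼 b : ι, N a b * e) := by
    simp only [mul_expect, ← expect_add_distrib]
    exact expect_congr rfl fun a _ => expect_congr rfl fun b _ => by ring
  have hd1 : ∀ a, |d a| ≤ 1 := abs_normDegree_le_one h1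
  have he1 : |e| ≤ 1 := (abs_expect_le hd1).trans_eq (Fintype.expect_const _)
  have hsq : 0 ≤ 𝔼 a, 𝔼 b, (K a b ^ 2
      + 2 * (U a b * K a b * (d a + d b + e + N a b))
      + (d a + d b + e + N a b) ^ 2) :=
    expect_expect_nonneg fun a b => completed_square_nonneg (h1 a b) _ _
  have hD1 : ∀ a, |D a| ≤ 1 := abs_walkTwo_le_one h1
  have hfp : -p ≤ f := by
    rw [hf, hp, ← expect_neg_distrib]
    exact expect_le_expect fun a _ => neg_sq_le_sq_mul _ (hD1 a)
  have her : r * e ≤ (p + q) / 2 := by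
    have hr' : |r| ≤ (p + q) / 2 := by
      have : (p + q) / 2 = 𝔼 a, (d a ^ 2 + D a ^ 2) / 2 := by
        rw [← expect_div, expect_add_distrib]
      rw [this]
      refine abs_expect_le fun a => abs_le.2 ⟨?_, ?_⟩
      · linarith [sq_nonneg (d a + D a)]
      · linarith [sq_nonneg (d a - D a)]
    exact mul_le_of_abs_le_of_abs_le_one hr' he1
  have hp0 : 0 ≤ p := expect_nonneg fun _ _ => sq_nonneg _
  have hq0 : 0 ≤ q := expect_nonneg fun _ _ => sq_nonneg _
  rw [expand, i1, iK, iDa, iDb, idd, iKDa, iKDb, iKdd, id2a, id2b, ida, idb, idNa, idNb,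
    iUda, iUdb, iUe, iUN, iUdDa, iUdDb, iUdaDb, iUdbDa, iUdda, iUddb]
  rw [expand_sq, ← hk, id2a, id2b, ie2, idd, ida, idb, idNa, idNb, iN] at hsq
  linarith only [hsq, iN2, her, hfp, hp0, hq0, sq_nonneg e]

/-! ### The inequality for the subdivided complete graph -/

/-- The averaged polynomial is `2⁶ (t(W) + t(1 - W))` for the subdivided `K₄` and `W = (1 + U) / 2`,
with the vertices `a, b, c` of the larger side of the spanning `K_{2,3}` integrated last. Dropping
the nonnegative form in `K(a,c) + K(b,c)` and `T` leaves a polynomial in which every term without a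
sign contains the degree function; it is bounded by completing the square in `K(a,b)`. -/
lemma subdividedK4_core [Nonempty ι] (hU : ∀ x y, U x y = U y x) (h1 : ∀ x y, |U x y| ≤ 1) :
    1 ≤ 𝔼 a, 𝔼 b, 𝔼 c,
      ((1 + normCodegree U a b + normCodegree U a c + normCodegree U b c) ^ 2
      + (normDegree U a + normDegree U b + normDegree U c + tripleCodegree U a b c) ^ 2
      + 2 * U a b * (1 + normCodegree U a b + normCodegree U a c + normCodegree U b c)
        * (normDegree U a + normDegree U b + normDegree U c + tripleCodegree U a b c)) := by
  set d := normDegree U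
  set D := walkTwo U
  set K := normCodegree U
  set e := 𝔼 z, d z
  set p := 𝔼 a, d a ^ 2 with hp
  set q := 𝔼 a, D a ^ 2 with hq
  set f := 𝔼 a, d a ^ 2 * D a with hf
  set k := 𝔼 a, 𝔼 b, K a b ^ 2 with hk
  have hKs : ∀ a b, K a b = K b a := normCodegree_comm
  have hUd : ∀ a, 𝔼 b, U a b = d a := fun _ => rfl
  have hUD : ∀ a, 𝔼 b, U a b * d b = D a := fun _ => rfl
  have hKD : ∀ a, 𝔼 b, K a b = D a := expect_normCodegree hU
  have hDp : 𝔼 a, D a = p := expect_walkTwo hU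
  have hdQ : 𝔼 a, d a * walkThree U a = q := expect_normDegree_mul_walkThree hU
  have i1 : 𝔼 _a : ι, 𝔼 _b : ι, (1 : ℝ) = 1 := by simp only [Fintype.expect_const]
  have iK : 𝔼 a, 𝔼 b, K a b = p :=
    expect_expect_normCodegree hU
  have iDa : 𝔼 a, 𝔼 _b : ι, D a = p := by rw [expect_expect_fst, hDp]
  have iDb : 𝔼 _a : ι, 𝔼 b, D b = p := by rw [expect_expect_snd, hDp]
  have idd : 𝔼 a, 𝔼 b, d a * d b = e ^ 2 :=
    expect_expect_normDegree_mul_normDegree U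
  have iKDa : 𝔼 a, 𝔼 b, K a b * D a = q :=
    expect_expect_normCodegree_mul_walkTwo_fst hU
  have iKDb : 𝔼 a, 𝔼 b, K a b * D b = q :=
    expect_expect_normCodegree_mul_walkTwo_snd hU
  have id2a : 𝔼 a, 𝔼 _b : ι, d a ^ 2 = p := expect_expect_fst fun a => d a ^ 2
  have id2b : 𝔼 _a : ι, 𝔼 b, d b ^ 2 = p := expect_expect_snd fun a => d a ^ 2
  have ida : 𝔼 a, 𝔼 _b : ι, d a * e = e ^ 2 :=
    expect_expect_normDegree_fst_mul U
  have idb : 𝔼 _a : ι, 𝔼 b, d b * e = e ^ 2 :=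
    expect_expect_normDegree_snd_mul U
  have ie2 : 𝔼 _a : ι, 𝔼 _b : ι, e ^ 2 = e ^ 2 := by simp only [Fintype.expect_const]
  have iUda : 𝔼 a, 𝔼 b, U a b * d a = p :=
    expect_expect_mul_normDegree_fst U
  have iUdb : 𝔼 a, 𝔼 b, U a b * d b = p :=
    expect_expect_mul_normDegree_snd hU
  have iUe : 𝔼 a, 𝔼 b, U a b * e = e ^ 2 :=
    expect_expect_mul_expect_normDegree U
  have iUdDa : 𝔼 a, 𝔼 b, U a b * (d a * D a) = f :=
    expect_expect_mul_normDegree_mul_walkTwo_fst U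
  have iUdDb : 𝔼 a, 𝔼 b, U a b * (d b * D b) = f :=
    expect_expect_mul_normDegree_mul_walkTwo_snd hU
  have iUdaDb : 𝔼 a, 𝔼 b, d a * (U a b * D b) = q :=
    expect_expect_normDegree_mul_mul_walkTwo hU
  have iUdbDa : 𝔼 a, 𝔼 b, d b * (U a b * D a) = q :=
    expect_expect_normDegree_snd_mul_mul_walkTwo hU
  set T := tripleCodegree U
  set R := pendantCodegree U
  set Q := walkThree U
  set g := 𝔼 a, d a ^ 3 with hg
  set S : ι → ι → ℝ := fun a b => 𝔼 z, U a z * U b z * D z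
  have hcS : ∀ a b, 𝔼 c, d c * T a b c = S a b := fun a b => expect_mul_tripleCodegree hU a b d
  have hcR : ∀ a b, 𝔼 c, T a b c = R a b := expect_tripleCodegree hU
  have hcQ : ∀ a, 𝔼 c, d c * K a c = Q a := expect_normDegree_mul_normCodegree hU
  -- integrating out `c`, after dropping the part of the form that is quadratic in `K a c + K b c`
  -- and `T a b c`
  have hlow : ∀ a b, 1 + 2 * (K a b + D a + D b) + K a b ^ 2 + 2 * K a b * (D a + D b)
      + ((d a + d b) ^ 2 + 2 * (d a + d b) * e + p)
      + 2 * ((d a + d b) * R a b + S a b)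
      + 2 * U a b * (d a + d b + e + R a b)
      + 2 * U a b * K a b * (d a + d b + e + R a b)
      + 2 * U a b * ((D a + D b) * (d a + d b) + Q a + Q b)
      ≤ 𝔼 c, ((1 + K a b + K a c + K b c) ^ 2 + (d a + d b + d c + T a b c) ^ 2
        + 2 * U a b * (1 + K a b + K a c + K b c) * (d a + d b + d c + T a b c)) := by
    intro a b
    have hc : 𝔼 c, (
        (1 + 2 * K a b + K a b ^ 2 + (d a + d b) ^ 2 + 2 * U a b * (d a + d b) * (1 + K a b)) * 1
        + (2 + 2 * K a b + 2 * U a b * (d a + d b)) * K a c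
        + (2 + 2 * K a b + 2 * U a b * (d a + d b)) * K b c
        + (2 * (d a + d b) + 2 * U a b * (1 + K a b)) * d c + 1 * d c ^ 2
        + (2 * (d a + d b) + 2 * U a b * (1 + K a b)) * T a b c
        + 2 * (d c * T a b c) + 2 * U a b * (d c * K a c) + 2 * U a b * (d c * K b c))
        = 1 + 2 * (K a b + D a + D b) + K a b ^ 2 + 2 * K a b * (D a + D b)
      + ((d a + d b) ^ 2 + 2 * (d a + d b) * e + p)
      + 2 * ((d a + d b) * R a b + S a b)
      + 2 * U a b * (d a + d b + e + R a b)
      + 2 * U a b * K a b * (d a + d b + e + R a b)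
      + 2 * U a b * ((D a + D b) * (d a + d b) + Q a + Q b) := by
      simp only [expect_add_distrib, ← mul_expect, hKD, hcR, hcS, hcQ, Fintype.expect_const]
      ring
    rw [← hc]
    refine expect_le_expect fun c _ => ?_
    -- the difference of the two sides is `X ^ 2 + T ^ 2 + 2 * U * X * T` with `X = K a c + K b c`
    linarith only [completed_square_nonneg (h1 a b) (K a c + K b c) (T a b c)]
  refine le_trans ?_ (expect_le_expect fun a _ => expect_le_expect fun b _ => hlow a b)
  have ip : 𝔼 _a : ι, 𝔼 _b : ι, p = p := by simp only [Fintype.expect_const]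
  have hRs : ∀ a b, R a b = R b a := fun a b => expect_congr rfl fun z _ => by ring
  have idRa : 𝔼 a, 𝔼 b, d a * R a b = f := by
    have := expect_expect_codegree hU d d fun _ => 1
    simp only [mul_one] at this
    exact this.trans (expect_congr rfl fun z _ => by rw [hUd, hUD]; ring)
  have idRb : 𝔼 a, 𝔼 b, d b * R a b = f := by
    rw [expect_comm, ← idRa]; simp only [hRs]
  have iS : 𝔼 a, 𝔼 b, S a b = f := by
    have := expect_expect_codegree hU D (fun _ => 1) fun _ => 1
    simp only [mul_one, one_mul] at this
    exact this.trans (expect_congr rfl fun z _ => by rw [hUd]; ring)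
  have iUQa : 𝔼 a, 𝔼 b, U a b * Q a = q := by
    rw [expect_expect_mul_fst, ← hdQ]; simp only [hUd, mul_comm]
  have iUQb : 𝔼 a, 𝔼 b, U a b * Q b = q := by
    rw [expect_expect_mul_snd hU, ← hdQ]; simp only [hUd, mul_comm]
  -- by these identities `2 U R` averages to the same as `U K (d a + d b)`; added to the term
  -- `2 U K (d a + d b)` already present, this gives the factor `3 / 2` in the square below
  have iUKda : 𝔼 a, 𝔼 b, U a b * K a b * d a = 𝔼 a, 𝔼 b, U a b * R a b :=
    (expect_mul_pendantCodegree hU).symm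
  have iUKdb : 𝔼 a, 𝔼 b, U a b * K a b * d b = 𝔼 a, 𝔼 b, U a b * R a b := by
    rw [expect_comm, ← iUKda]; simp only [hU, hKs]
  have iR : 𝔼 a, 𝔼 b, R a b * e = g * e := by
    have := expect_expect_codegree hU d (fun _ => 1) fun _ => 1
    simp only [mul_one, one_mul] at this
    simp only [← expect_mul]
    rw [show 𝔼 a, 𝔼 b, R a b = g from
      this.trans (expect_congr rfl fun z _ => by rw [hUd]; ring)]
  have iR2 : 𝔼 a, 𝔼 b, R a b ^ 2 ≤ p := by
    rw [← ip]
    exact expect_le_expect fun a _ => expect_le_expect fun b _ => sq_pendantCodegree_le h1 a b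
  have expand : 𝔼 a, 𝔼 b, (1 + 2 * (K a b + D a + D b) + K a b ^ 2 + 2 * K a b * (D a + D b)
      + ((d a + d b) ^ 2 + 2 * (d a + d b) * e + p)
      + 2 * ((d a + d b) * R a b + S a b)
      + 2 * U a b * (d a + d b + e + R a b)
      + 2 * U a b * K a b * (d a + d b + e + R a b)
      + 2 * U a b * ((D a + D b) * (d a + d b) + Q a + Q b))
      = (𝔼 a : ι, 𝔼 b : ι, (1 : ℝ)) + 2 * (𝔼 a : ι, 𝔼 b : ι, K a b)
        + 2 * (𝔼 a : ι, 𝔼 b : ι, D a) + 2 * (𝔼 a : ι, 𝔼 b : ι, D b)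
        + (𝔼 a : ι, 𝔼 b : ι, K a b ^ 2) + 2 * (𝔼 a : ι, 𝔼 b : ι, K a b * D a)
        + 2 * (𝔼 a : ι, 𝔼 b : ι, K a b * D b) + (𝔼 a : ι, 𝔼 b : ι, d a ^ 2)
        + (𝔼 a : ι, 𝔼 b : ι, d b ^ 2) + 2 * (𝔼 a : ι, 𝔼 b : ι, d a * d b)
        + 2 * (𝔼 a : ι, 𝔼 b : ι, d a * e) + 2 * (𝔼 a : ι, 𝔼 b : ι, d b * e)
        + (𝔼 a : ι, 𝔼 b : ι, p) + 2 * (𝔼 a : ι, 𝔼 b : ι, d a * R a b)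
        + 2 * (𝔼 a : ι, 𝔼 b : ι, d b * R a b) + 2 * (𝔼 a : ι, 𝔼 b : ι, S a b)
        + 2 * (𝔼 a : ι, 𝔼 b : ι, U a b * d a) + 2 * (𝔼 a : ι, 𝔼 b : ι, U a b * d b)
        + 2 * (𝔼 a : ι, 𝔼 b : ι, U a b * e) + 2 * (𝔼 a : ι, 𝔼 b : ι, U a b * R a b)
        + 2 * (𝔼 a : ι, 𝔼 b : ι, U a b * K a b * d a)
        + 2 * (𝔼 a : ι, 𝔼 b : ι, U a b * K a b * d b)
        + 2 * (𝔼 a : ι, 𝔼 b : ι, U a b * K a b * e)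
        + 2 * (𝔼 a : ι, 𝔼 b : ι, U a b * K a b * R a b)
        + 2 * (𝔼 a : ι, 𝔼 b : ι, U a b * (d a * D a))
        + 2 * (𝔼 a : ι, 𝔼 b : ι, U a b * (d b * D b))
        + 2 * (𝔼 a : ι, 𝔼 b : ι, d a * (U a b * D b))
        + 2 * (𝔼 a : ι, 𝔼 b : ι, d b * (U a b * D a)) + 2 * (𝔼 a : ι, 𝔼 b : ι, U a b * Q a)
        + 2 * (𝔼 a : ι, 𝔼 b : ι, U a b * Q b) := by
    simp only [mul_expect, ← expect_add_distrib]
    exact expect_congr rfl fun a _ => expect_congr rfl fun b _ => by ring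
  have expand_sq : 𝔼 a, 𝔼 b, (K a b ^ 2
      + 2 * (U a b * K a b * (3 / 2 * d a + 3 / 2 * d b + e + R a b))
      + (3 / 2 * d a + 3 / 2 * d b + e + R a b) ^ 2)
      = (𝔼 a : ι, 𝔼 b : ι, K a b ^ 2) + 3 * (𝔼 a : ι, 𝔼 b : ι, U a b * K a b * d a)
        + 3 * (𝔼 a : ι, 𝔼 b : ι, U a b * K a b * d b)
        + 2 * (𝔼 a : ι, 𝔼 b : ι, U a b * K a b * e)
        + 2 * (𝔼 a : ι, 𝔼 b : ι, U a b * K a b * R a b) + (9 / 4) * (𝔼 a : ι, 𝔼 b : ι, d a ^ 2)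
        + (9 / 4) * (𝔼 a : ι, 𝔼 b : ι, d b ^ 2) + (𝔼 a : ι, 𝔼 b : ι, e ^ 2)
        + (𝔼 a : ι, 𝔼 b : ι, R a b ^ 2) + (9 / 2) * (𝔼 a : ι, 𝔼 b : ι, d a * d b)
        + 3 * (𝔼 a : ι, 𝔼 b : ι, d a * e) + 3 * (𝔼 a : ι, 𝔼 b : ι, d b * e)
        + 3 * (𝔼 a : ι, 𝔼 b : ι, d a * R a b) + 3 * (𝔼 a : ι, 𝔼 b : ι, d b * R a b)
        + 2 * (𝔼 a : ι, 𝔼 b : ι, R a b * e) := by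
    simp only [mul_expect, ← expect_add_distrib]
    exact expect_congr rfl fun a _ => expect_congr rfl fun b _ => by ring
  have hd1 : ∀ a, |d a| ≤ 1 := abs_normDegree_le_one h1
  have hep : e ^ 2 ≤ p := sq_expect_le d
  have he1 : |e| ≤ 1 := (abs_expect_le hd1).trans_eq (Fintype.expect_const _)
  have hsq : 0 ≤ 𝔼 a, 𝔼 b, (K a b ^ 2
      + 2 * (U a b * K a b * (3 / 2 * d a + 3 / 2 * d b + e + R a b))
      + (3 / 2 * d a + 3 / 2 * d b + e + R a b) ^ 2) :=
    expect_expect_nonneg fun a b => completed_square_nonneg (h1 a b) _ _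
  have hfq : -p ≤ 4 * f + 4 * q := by
    rw [hf, hp, hq, ← expect_neg_distrib, mul_expect, mul_expect, ← expect_add_distrib]
    exact expect_le_expect fun a _ => neg_sq_le_sq_mul_add_sq (hd1 a) _
  have hge : g * e ≤ p := by
    have hg' : |g| ≤ p := abs_expect_le fun a => by
      rw [pow_succ, abs_mul, abs_of_nonneg (sq_nonneg _)]
      exact mul_le_of_le_one_right (sq_nonneg _) (hd1 a)
    exact mul_le_of_abs_le_of_abs_le_one hg' he1
  have hq0 : 0 ≤ q := expect_nonneg fun _ _ => sq_nonneg _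
  rw [expand, i1, ip, iK, iDa, iDb, ← hk, iKDa, iKDb, id2a, id2b, idd, ida, idb, idRa, idRb, iS,
    iUda, iUdb, iUe, iUKda, iUKdb, iUdDa, iUdDb, iUdaDb, iUdbDa, iUQa, iUQb]
  rw [expand_sq, ← hk, iUKda, iUKdb, id2a, id2b, ie2, idd, ida, idb, idRa, idRb, iR] at hsq
  linarith only [hsq, iR2, hge, hfq, hep, hq0, sq_nonneg e]

end

/-! ### From finite kernels to graphons -/

section
variable {V α : Type*}

/-- The product of `W` over the edges of the image of `H` under the vertex map `φ`. -/
def edgeWeight (H : SimpleGraph V) [Fintype H.edgeSet] (W : α → α → ℝ)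
    (hW : ∀ x y, W x y = W y x) (φ : V → α) : ℝ :=
  ∏ e ∈ H.edgeFinset, Sym2.lift ⟨fun u v => W (φ u) (φ v), fun u v => hW (φ u) (φ v)⟩ e

lemma edgeWeight_mem_Icc (H : SimpleGraph V) [Fintype H.edgeSet] {W : α → α → ℝ}
    (hW : ∀ x y, W x y = W y x) (h0 : ∀ x y, 0 ≤ W x y) (h1 : ∀ x y, W x y ≤ 1) (φ : V → α) :
    edgeWeight H W hW φ ∈ Set.Icc 0 1 := by
  constructor
  · refine prod_nonneg fun e _ => ?_
    induction e using Sym2.ind with | _ u v => exact h0 _ _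
  · refine prod_le_one (fun e _ => ?_) fun e _ => ?_
    · induction e using Sym2.ind with | _ u v => exact h0 _ _
    · induction e using Sym2.ind with | _ u v => exact h1 _ _

/-- The inequality `t_H(W) + t_H(1 - W) ≥ 2 ^ (1 - e(H))` for kernels `W` on finite sets with
uniform weights. Diagonal values of `W` are allowed to be nonzero. -/
def FinitelyCommon [Fintype V] [DecidableEq V] (H : SimpleGraph V) [Fintype H.edgeSet] : Prop :=
  ∀ (n : ℕ) [NeZero n] (W : Fin n → Fin n → ℝ) (hW : ∀ x y, W x y = W y x),
    (∀ x y, 0 ≤ W x y) → (∀ x y, W x y ≤ 1) →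
    (2 : ℝ) ^ (1 - (#H.edgeFinset : ℤ)) ≤
      𝔼 φ : V → Fin n, (edgeWeight H W hW φ +
        edgeWeight H (fun x y => 1 - W x y) (fun x y => by rw [hW]) φ)

/-- Restricting a sum over vertex maps to the injective ones loses at most the bound times the
number of non-injective maps. -/
lemma sum_le_sum_embedding_add [Fintype V] [DecidableEq V] {n : ℕ} {F : (V → Fin n) → ℝ} {C : ℝ}
    (hF : ∀ φ, F φ ≤ C) :
    ∑ φ, F φ ≤ ∑ f : V ↪ Fin n, F f
      + C * ((n : ℝ) ^ Fintype.card V - n.descFactorial (Fintype.card V)) := by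
  classical
  have hinj : ∑ f : V ↪ Fin n, F f = ∑ φ with Function.Injective φ, F φ := by
    rw [← sum_subtype_eq_sum_filter, subtype_univ]
    exact Fintype.sum_equiv (Equiv.subtypeInjectiveEquivEmbedding V (Fin n)).symm _ _ fun f => rfl
  have hcard : (#{φ : V → Fin n | ¬ Function.Injective φ} : ℝ)
      = (n : ℝ) ^ Fintype.card V - n.descFactorial (Fintype.card V) := by
    have h1 : #{φ : V → Fin n | Function.Injective φ} = n.descFactorial (Fintype.card V) := by
      rw [← Fintype.card_subtype,
        Fintype.card_congr (Equiv.subtypeInjectiveEquivEmbedding V (Fin n)),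
        Fintype.card_embedding_eq, Fintype.card_fin]
    have h2 := card_filter_add_card_filter_not (s := (univ : Finset (V → Fin n)))
      fun φ => Function.Injective φ
    rw [h1, card_univ, Fintype.card_fun, Fintype.card_fin] at h2
    have h3 := congrArg (Nat.cast (R := ℝ)) h2
    push_cast at h3
    linarith
  rw [← sum_filter_add_sum_filter_not univ fun φ : V → Fin n => Function.Injective φ, hinj, ← hcard,
    mul_comm, ← nsmul_eq_mul]
  gcongr
  exact sum_le_card_nsmul _ _ _ fun φ _ => hF φ

lemma FinitelyCommon.le_sum_embedding [Fintype V] [DecidableEq V] {H : SimpleGraph V}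
    [Fintype H.edgeSet] (hH : FinitelyCommon H) {n : ℕ} [NeZero n] (W : Fin n → Fin n → ℝ)
    (hW : ∀ x y, W x y = W y x) (h0 : ∀ x y, 0 ≤ W x y) (h1 : ∀ x y, W x y ≤ 1) :
    (2 : ℝ) ^ (1 - (#H.edgeFinset : ℤ)) * (n : ℝ) ^ Fintype.card V
      - 2 * ((n : ℝ) ^ Fintype.card V - n.descFactorial (Fintype.card V))
      ≤ ∑ f : V ↪ Fin n, (edgeWeight H W hW f +
        edgeWeight H (fun x y => 1 - W x y) (fun x y => by rw [hW]) f) := by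
  have hsum := sum_le_sum_embedding_add (V := V) (n := n) (C := 2)
    (F := fun φ => edgeWeight H W hW φ +
        edgeWeight H (fun x y => 1 - W x y) (fun x y => by rw [hW]) φ) fun φ => by
      have e1 := (edgeWeight_mem_Icc H hW h0 h1 φ).2
      have e2 := (edgeWeight_mem_Icc H (W := fun x y => 1 - W x y) (fun x y => by rw [hW])
        (fun x y => sub_nonneg.2 (h1 x y)) (fun x y => sub_le_self _ (h0 x y)) φ).2
      linarith
  have hexp := hH n W hW h0 h1
  rw [Fintype.expect_eq_sum_div_card, Fintype.card_fun, Fintype.card_fin, le_div_iff₀ (by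
    have := NeZero.pos n; positivity)] at hexp
  push_cast at hexp
  linarith

lemma tendsto_pow_div_descFactorial (k : ℕ) :
    Tendsto (fun n : ℕ => (n : ℝ) ^ k / n.descFactorial k) atTop (𝓝 1) := by
  refine (Asymptotics.isEquivalent_iff_tendsto_one ?_).1 (isEquivalent_descFactorial k).symm
  filter_upwards [eventually_ge_atTop k] with n hn
  exact_mod_cast (Nat.descFactorial_pos.2 hn).ne'

lemma tendsto_injective_bound (t : ℝ) (k : ℕ) :
    Tendsto (fun n : ℕ => t * ((n : ℝ) ^ k / n.descFactorial k)
      - 2 * ((n : ℝ) ^ k / n.descFactorial k - 1)) atTop (𝓝 t) := by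
  have h := tendsto_pow_div_descFactorial k
  simpa using (h.const_mul t).sub ((h.sub_const 1).const_mul 2)

/-- Distinct coordinates of a uniform point of the cube are independent and uniform. -/
lemma measurePreserving_comp_embedding [Fintype V] {n : ℕ} (f : V ↪ Fin n) :
    MeasurePreserving (fun x : Fin n → unitInterval => fun v => x (f v)) volume volume := by
  have hm : Measurable fun (x : Fin n → unitInterval) v => x (f v) :=
    measurable_pi_lambda _ fun v => measurable_pi_apply (f v)
  refine ⟨hm, (Measure.pi_eq fun s hs => ?_).symm⟩
  have hpre : (fun (x : Fin n → unitInterval) v => x (f v)) ⁻¹' Set.univ.pi s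
      = Set.univ.pi (Function.extend f s fun _ => Set.univ) := by
    ext x
    simp only [Set.mem_preimage, Set.mem_univ_pi]
    refine ⟨fun h i => ?_, fun h v => by simpa [f.injective.extend_apply] using h (f v)⟩
    by_cases hi : ∃ v, f v = i
    · obtain ⟨v, rfl⟩ := hi
      simpa [f.injective.extend_apply] using h v
    · simp [Function.extend_apply' _ _ _ hi]
  rw [Measure.map_apply hm (MeasurableSet.univ_pi hs), hpre, volume_pi_pi]
  refine (Fintype.prod_of_injective f f.injective _ _ (fun i hi => ?_) fun v => ?_).symm
  · rw [Function.extend_apply' _ _ _ (by simpa using hi), measure_univ]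
  · rw [f.injective.extend_apply]

lemma measurable_edgeWeight (H : SimpleGraph V) [Fintype H.edgeSet] (W : Graphon) :
    Measurable (edgeWeight H W.toFun W.symm) := by
  refine Finset.measurable_prod _ fun e _ => ?_
  induction e using Sym2.ind with
  | _ u v =>
    have h : Measurable fun x : V → unitInterval => (x u, x v) :=
      (measurable_pi_apply u).prodMk (measurable_pi_apply v)
    exact W.measurable_toFun.comp h

lemma integral_edgeWeight_comp [Fintype V] (H : SimpleGraph V) [Fintype H.edgeSet]
    (W : Graphon) {n : ℕ} (f : V ↪ Fin n) :
    ∫ x : Fin n → unitInterval, edgeWeight H W.toFun W.symm (fun v => x (f v)) =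
      W.homDensity H := by
  have hf := measurePreserving_comp_embedding f
  rw [← integral_map hf.aemeasurable (measurable_edgeWeight H W).aestronglyMeasurable, hf.map_eq]
  rfl

lemma integrable_edgeWeight_comp [Fintype V] (H : SimpleGraph V) [Fintype H.edgeSet]
    (W : Graphon) {n : ℕ} (f : V ↪ Fin n) : Integrable fun x : Fin n → unitInterval =>
      edgeWeight H W.toFun W.symm (fun v => x (f v)) := by
  refine Integrable.of_mem_Icc 0 1
    ((measurable_edgeWeight H W).comp (measurePreserving_comp_embedding f).measurable).aemeasurable
    (ae_of_all _ fun x => edgeWeight_mem_Icc H W.symm W.nonneg W.le_one _)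

/-- Sampling: applying the finite inequality to the kernel induced on `n` random points and letting
`n → ∞` gives the inequality for graphons. -/
theorem FinitelyCommon.le_monoDensity [Fintype V] [DecidableEq V] {H : SimpleGraph V}
    [Fintype H.edgeSet] (hH : FinitelyCommon H) (W : Graphon) :
    (2 : ℝ) ^ (1 - (#H.edgeFinset : ℤ)) ≤ W.monoDensity H := by
  set t : ℝ := (2 : ℝ) ^ (1 - (#H.edgeFinset : ℤ))
  set k := Fintype.card V
  have hn : ∀ n : ℕ, n ≠ 0 → t * (n : ℝ) ^ k - 2 * ((n : ℝ) ^ k - n.descFactorial k)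
      ≤ n.descFactorial k * W.monoDensity H := by
    intro n hn
    have : NeZero n := ⟨hn⟩
    have hint : ∀ f : V ↪ Fin n, Integrable fun x : Fin n → unitInterval =>
        edgeWeight H W.toFun W.symm (fun v => x (f v))
          + edgeWeight H W.compl.toFun W.compl.symm (fun v => x (f v)) := fun f =>
      (integrable_edgeWeight_comp H W f).add (integrable_edgeWeight_comp H W.compl f)
    calc t * (n : ℝ) ^ k - 2 * ((n : ℝ) ^ k - n.descFactorial k)
        = ∫ _x : Fin n → unitInterval, (t * (n : ℝ) ^ k
            - 2 * ((n : ℝ) ^ k - n.descFactorial k)) := by simp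
      _ ≤ ∫ x : Fin n → unitInterval, ∑ f : V ↪ Fin n,
            (edgeWeight H W.toFun W.symm (fun v => x (f v))
              + edgeWeight H W.compl.toFun W.compl.symm (fun v => x (f v))) := by
        refine integral_mono (integrable_const _) (integrable_finsetSum _ fun f _ => hint f)
          fun x => ?_
        exact hH.le_sum_embedding (fun i j => W.toFun (x i) (x j)) (fun i j => W.symm _ _)
          (fun i j => W.nonneg _ _) fun i j => W.le_one _ _
      _ = n.descFactorial k * W.monoDensity H := by
        rw [integral_finsetSum _ fun f _ => hint f]
        simp only [integral_add (integrable_edgeWeight_comp H W _)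
          (integrable_edgeWeight_comp H W.compl _), integral_edgeWeight_comp]
        rw [sum_const, card_univ, Fintype.card_embedding_eq, Fintype.card_fin, nsmul_eq_mul,
          Graphon.monoDensity]
  refine le_of_tendsto (tendsto_injective_bound t k) ?_
  filter_upwards [eventually_ge_atTop k, eventually_gt_atTop 0] with n hk h0
  have hpos : (0 : ℝ) < n.descFactorial k := by exact_mod_cast Nat.descFactorial_pos.2 hk
  have := hn n h0.ne'
  rw [← mul_le_mul_iff_right₀ hpos]
  refine le_of_eq_of_le ?_ this
  field_simp

/-! ### Ramsey multiplicity -/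

lemma copy_equiv_nonempty (H : SimpleGraph V) (G : SimpleGraph α) :
    Nonempty (H.Copy G ≃ {f : V ↪ α // ∀ e ∈ H.edgeSet, e.map f ∈ G.edgeSet}) :=
  ⟨{ toFun := fun c => ⟨c.toEmbedding, fun e he => (c.mapEdgeSet ⟨e, he⟩).2⟩
     invFun := fun f => ⟨⟨f.1, fun {u v} h => f.2 s(u, v) h⟩, f.1.injective⟩
     left_inv := fun _ => rfl
     right_inv := fun _ => rfl }⟩

lemma labelledCopyCount_eq_card [Fintype V] [DecidableEq V] [Fintype α] (H : SimpleGraph V)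
    (G : SimpleGraph α) [DecidablePred fun f : V ↪ α => ∀ e ∈ H.edgeSet, e.map f ∈ G.edgeSet]
    [DecidableEq α] :
    G.labelledCopyCount H = #{f : V ↪ α | ∀ e ∈ H.edgeSet, e.map f ∈ G.edgeSet} := by
  obtain ⟨E⟩ := copy_equiv_nonempty H G
  have hE : Nat.card (H.Copy G) = #{f : V ↪ α | ∀ e ∈ H.edgeSet, e.map f ∈ G.edgeSet} := by
    rw [Nat.card_congr E, Nat.card_eq_fintype_card]
    exact Fintype.card_of_subtype _ fun f => by simp
  classical
  rw [← hE, Nat.card_eq_fintype_card, SimpleGraph.labelledCopyCount]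
  congr!

lemma prod_eq_ite_of_forall {β : Type*} (s : Finset β) (g : β → ℝ) (p : β → Prop)
    [DecidablePred p] [Decidable (∀ e ∈ s, p e)] (hg : ∀ e ∈ s, g e = if p e then 1 else 0) :
    ∏ e ∈ s, g e = if ∀ e ∈ s, p e then 1 else 0 := by
  split_ifs with h
  · exact prod_eq_one fun e he => by rw [hg e he, if_pos (h e he)]
  · push Not at h
    obtain ⟨e, he, hp⟩ := h
    exact prod_eq_zero he (by rw [hg e he, if_neg hp])

/-- Off the diagonal `W` is the indicator of `G`; the diagonal is irrelevant as `f` is injective. -/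
lemma edgeWeight_eq_ite (H : SimpleGraph V) [Fintype H.edgeSet] (G : SimpleGraph α)
    (W : α → α → ℝ) (hW : ∀ x y, W x y = W y x) (f : V ↪ α)
    [Decidable (∀ e ∈ H.edgeSet, e.map f ∈ G.edgeSet)]
    [DecidableRel G.Adj]
    (hG : ∀ x y, x ≠ y → W x y = if G.Adj x y then 1 else 0) :
    edgeWeight H W hW f = if ∀ e ∈ H.edgeSet, e.map f ∈ G.edgeSet then 1 else 0 := by
  classical
  rw [edgeWeight, prod_eq_ite_of_forall _ _ fun e => e.map f ∈ G.edgeSet]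
  · simp only [SimpleGraph.mem_edgeFinset]
  · intro e he
    rw [SimpleGraph.mem_edgeFinset] at he
    induction e using Sym2.ind with
    | _ u v =>
      have huv : f u ≠ f v := f.injective.ne (SimpleGraph.Adj.ne he)
      simpa using hG _ _ huv

/-- Colour `1` corresponds to `W` and colour `0` to `1 - W`. On the diagonal `1 - W` is `1` and so
not the indicator of colour `0`, which injective vertex maps do not see. -/
lemma monoCopyCount_eq_sum [Fintype V] [DecidableEq V] (H : SimpleGraph V)
    [Fintype H.edgeSet] {n : ℕ}
    (c : SimpleGraph.TopEdgeLabeling (Fin n) (Fin 2)) (W : Fin n → Fin n → ℝ)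
    (hW : ∀ x y, W x y = W y x)
    (hc : W = fun x y => if (c.labelGraph 1).Adj x y then 1 else 0) :
    (H.monoCopyCount c : ℝ) = ∑ f : V ↪ Fin n, (edgeWeight H W hW f +
        edgeWeight H (fun x y => 1 - W x y) (fun x y => by rw [hW]) f) := by
  classical
  rw [SimpleGraph.monoCopyCount, Fin.sum_univ_two, add_comm, sum_add_distrib, Nat.cast_add]
  congr 1
  · rw [labelledCopyCount_eq_card, card_filter, Nat.cast_sum]
    refine sum_congr rfl fun f _ => ?_
    rw [edgeWeight_eq_ite H (c.labelGraph 1) W hW f fun x y _ => by rw [hc]]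
    push_cast; rfl
  · rw [labelledCopyCount_eq_card, card_filter, Nat.cast_sum]
    refine sum_congr rfl fun f _ => ?_
    rw [edgeWeight_eq_ite H (c.labelGraph 0) _ _ f fun x y hxy => ?_]
    · push_cast; rfl
    · simp only [hc, SimpleGraph.TopEdgeLabeling.labelGraph_adj]
      have h01 : ∀ i : Fin 2, i = 0 ↔ ¬ i = 1 := by decide
      by_cases h : c.get x y hxy = 1 <;> simp [hxy, h, h01]

lemma exists_ramseyMultiplicity_eq [Fintype V] (H : SimpleGraph V) (n : ℕ) :
    ∃ c : SimpleGraph.TopEdgeLabeling (Fin n) (Fin 2),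
      H.monoCopyCount c = H.ramseyMultiplicity n :=
  Nat.sInf_mem (Set.range_nonempty _)

lemma FinitelyCommon.le_ramseyMultiplicity [Fintype V] [DecidableEq V] {H : SimpleGraph V}
    [Fintype H.edgeSet] (hH : FinitelyCommon H) {n : ℕ} (hn : n ≠ 0) :
    (2 : ℝ) ^ (1 - (#H.edgeFinset : ℤ)) * (n : ℝ) ^ Fintype.card V
      - 2 * ((n : ℝ) ^ Fintype.card V - n.descFactorial (Fintype.card V))
      ≤ H.ramseyMultiplicity n := by
  classical
  have : NeZero n := ⟨hn⟩
  obtain ⟨c, hc⟩ := exists_ramseyMultiplicity_eq H n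
  set W : Fin n → Fin n → ℝ := fun x y => if (c.labelGraph 1).Adj x y then 1 else 0 with hWdef
  have hW : ∀ x y, W x y = W y x := fun x y => by simp only [hWdef, SimpleGraph.adj_comm]
  rw [← hc, monoCopyCount_eq_sum H c W hW hWdef]
  refine hH.le_sum_embedding W hW (fun x y => ?_) fun x y => ?_
  · rw [hWdef]; dsimp only; split_ifs <;> norm_num
  · rw [hWdef]; dsimp only; split_ifs <;> norm_num

lemma two_pow_card_mul_card_filter_eq {β : Type*} [Fintype β] [DecidableEq β] (S : Finset β)
    (i : Fin 2) :
    2 ^ #S * #{c : β → Fin 2 | ∀ x ∈ S, c x = i} = 2 ^ Fintype.card β := by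
  have hfilter : ({c : β → Fin 2 | ∀ x ∈ S, c x = i} : Finset _)
      = Fintype.piFinset fun x => if x ∈ S then {i} else univ := by
    ext c
    rw [Fintype.mem_piFinset, mem_filter]
    refine ⟨fun h x => ?_, fun h => ⟨mem_univ _, fun x hx => ?_⟩⟩
    · split_ifs with hx
      · exact mem_singleton.2 (h.2 x hx)
      · exact mem_univ _
    · have := h x
      rwa [if_pos hx, mem_singleton] at this
  have hcard : ∀ x, #(if x ∈ S then {i} else univ : Finset (Fin 2)) = if x ∈ S then 1 else 2 := by
    intro x; split_ifs <;> simp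
  rw [hfilter, Fintype.card_piFinset]
  simp only [hcard]
  rw [prod_ite, prod_const_one, one_mul, prod_const, ← pow_add, filter_notMem_eq_sdiff,
    ← card_univ, add_comm, card_sdiff_add_card_eq_card (subset_univ S)]

/-- Prescribing the colour of the image of `H` leaves the colours of all other edges free. -/
lemma two_pow_mul_card_labelGraph_copy (H : SimpleGraph V) [Fintype H.edgeSet] {n : ℕ}
    (f : V ↪ Fin n) (i : Fin 2)
    [DecidablePred fun c : SimpleGraph.TopEdgeLabeling (Fin n) (Fin 2) =>
      ∀ e ∈ H.edgeSet, e.map f ∈ (c.labelGraph i).edgeSet] :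
    2 ^ #H.edgeFinset * #{c : SimpleGraph.TopEdgeLabeling (Fin n) (Fin 2) |
        ∀ e ∈ H.edgeSet, e.map f ∈ (c.labelGraph i).edgeSet}
      = Fintype.card (SimpleGraph.TopEdgeLabeling (Fin n) (Fin 2)) := by
  classical
  let m : H.edgeSet ↪ (⊤ : SimpleGraph (Fin n)).edgeSet :=
    SimpleGraph.Copy.mapEdgeSet ⟨⟨f, fun h => f.injective.ne h.ne⟩, f.injective⟩
  have hmem : ∀ (c : SimpleGraph.TopEdgeLabeling (Fin n) (Fin 2)) (e) (he : e ∈ H.edgeSet),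
      e.map f ∈ (c.labelGraph i).edgeSet ↔ c (m ⟨e, he⟩) = i := by
    intro c e he
    induction e using Sym2.ind with
    | _ u v =>
      have huv : f u ≠ f v := f.injective.ne (SimpleGraph.Adj.ne he)
      have h : (c.labelGraph i).Adj (f u) (f v) ↔ _ :=
        SimpleGraph.TopEdgeLabeling.labelGraph_adj _ _
      exact h.trans ⟨fun h => h.2, fun h => ⟨huv, h⟩⟩
  have hcard : #{c : SimpleGraph.TopEdgeLabeling (Fin n) (Fin 2) |
        ∀ e ∈ H.edgeSet, e.map f ∈ (c.labelGraph i).edgeSet}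
      = #{c : (⊤ : SimpleGraph (Fin n)).edgeSet → Fin 2 | ∀ x ∈ univ.map m, c x = i} := by
    refine card_nbij' id id (fun c hc => ?_) (fun c hc => ?_) (fun _ _ => rfl) fun _ _ => rfl
    · refine mem_filter.2 ⟨mem_univ _, fun x hx => ?_⟩
      obtain ⟨e, -, rfl⟩ := mem_map.1 hx
      exact (hmem c e.1 e.2).1 ((mem_filter.1 hc).2 e.1 e.2)
    · exact mem_filter.2 ⟨mem_univ _, fun e he =>
        (hmem c e he).2 ((mem_filter.1 hc).2 _ (mem_map_of_mem m (mem_univ _)))⟩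
  have hS : #(univ.map m) = #H.edgeFinset := by
    rw [card_map, card_univ, SimpleGraph.edgeFinset_card]
  rw [hcard, ← hS, two_pow_card_mul_card_filter_eq]
  exact (Fintype.card_fun.trans (by rw [Fintype.card_fin])).symm

/-- The total number of monochromatic copies over all colourings: a fixed injective vertex map
is a monochromatic copy in a proportion `2 ^ (1 - e(H))` of them. -/
lemma sum_monoCopyCount [Fintype V] [DecidableEq V] (H : SimpleGraph V)
    [Fintype H.edgeSet] (n : ℕ) :
    2 ^ #H.edgeFinset * ∑ c : SimpleGraph.TopEdgeLabeling (Fin n) (Fin 2), H.monoCopyCount c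
      = 2 * n.descFactorial (Fintype.card V)
        * Fintype.card (SimpleGraph.TopEdgeLabeling (Fin n) (Fin 2)) := by
  classical
  have hi : ∀ i : Fin 2, 2 ^ #H.edgeFinset * ∑ c : SimpleGraph.TopEdgeLabeling (Fin n) (Fin 2),
      (c.labelGraph i).labelledCopyCount H = n.descFactorial (Fintype.card V)
        * Fintype.card (SimpleGraph.TopEdgeLabeling (Fin n) (Fin 2)) := by
    intro i
    simp only [labelledCopyCount_eq_card, card_filter]
    rw [sum_comm]
    simp only [← card_filter]
    rw [mul_sum]
    simp only [two_pow_mul_card_labelGraph_copy]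
    rw [sum_const, card_univ, Fintype.card_embedding_eq, Fintype.card_fin, smul_eq_mul]
  simp only [SimpleGraph.monoCopyCount]
  rw [sum_comm, Fin.sum_univ_two, mul_add, hi, hi]
  ring

lemma ramseyMultiplicity_le [Fintype V] [DecidableEq V] (H : SimpleGraph V)
    [Fintype H.edgeSet] (n : ℕ) :
    (H.ramseyMultiplicity n : ℝ) ≤
      (2 : ℝ) ^ (1 - (#H.edgeFinset : ℤ)) * n.descFactorial (Fintype.card V) := by
  have hpos : 0 < Fintype.card (SimpleGraph.TopEdgeLabeling (Fin n) (Fin 2)) := Fintype.card_pos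
  have h1 : Fintype.card (SimpleGraph.TopEdgeLabeling (Fin n) (Fin 2)) * H.ramseyMultiplicity n
      ≤ ∑ c : SimpleGraph.TopEdgeLabeling (Fin n) (Fin 2), H.monoCopyCount c := by
    rw [← card_univ, ← smul_eq_mul]
    exact card_nsmul_le_sum _ _ _ fun c _ => Nat.sInf_le (Set.mem_range_self c)
  have h2 : 2 ^ #H.edgeFinset * H.ramseyMultiplicity n
      ≤ 2 * n.descFactorial (Fintype.card V) := by
    refine le_of_mul_le_mul_right ?_ hpos
    rw [← sum_monoCopyCount H, mul_assoc, mul_comm (H.ramseyMultiplicity n)]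
    exact Nat.mul_le_mul_left _ h1
  have h3 : (2 : ℝ) ^ #H.edgeFinset * H.ramseyMultiplicity n
      ≤ 2 * n.descFactorial (Fintype.card V) := by exact_mod_cast h2
  rw [zpow_sub₀ two_ne_zero, zpow_one, zpow_natCast, div_mul_eq_mul_div,
    le_div_iff₀ (by positivity)]
  linarith

theorem FinitelyCommon.isCommon [Fintype V] [DecidableEq V] {H : SimpleGraph V}
    [Fintype H.edgeSet] (hH : FinitelyCommon H) : H.IsCommon := by
  set t : ℝ := (2 : ℝ) ^ (1 - (#H.edgeFinset : ℤ)) with ht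
  set k := Fintype.card V
  refine tendsto_of_tendsto_of_tendsto_of_le_of_le' (tendsto_injective_bound t k)
    tendsto_const_nhds ?_ ?_
  · filter_upwards [eventually_ge_atTop k, eventually_gt_atTop 0] with n hk h0
    have hpos : (0 : ℝ) < n.descFactorial k := by exact_mod_cast Nat.descFactorial_pos.2 hk
    rw [le_div_iff₀ hpos]
    refine le_of_eq_of_le ?_ (hH.le_ramseyMultiplicity h0.ne')
    field_simp
    rfl
  · filter_upwards [eventually_ge_atTop k] with n hk
    have hpos : (0 : ℝ) < n.descFactorial k := by exact_mod_cast Nat.descFactorial_pos.2 hk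
    rw [div_le_iff₀ hpos]
    exact ramseyMultiplicity_le H n

end

/-! ### The two graphs -/

section
variable {ι : Type*}

lemma edgeFinset_graphH3 :
    graphH3.edgeFinset = {s(0, 1), s(1, 2), s(2, 3), s(3, 4), s(4, 0), s(1, 4)} := by
  decide

lemma edgeFinset_graphH4 :
    graphH4.edgeFinset = {s(0, 1), s(0, 2), s(1, 2), s(1, 3), s(2, 3), s(0, 4), s(4, 3)} := by
  decide

lemma edgeWeight_graphH3 (W : ι → ι → ℝ) (hW : ∀ x y, W x y = W y x) (φ : Fin 5 → ι) :
    edgeWeight graphH3 W hW φ = W (φ 0) (φ 1) * W (φ 1) (φ 2) * W (φ 2) (φ 3) * W (φ 3) (φ 4)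
      * W (φ 4) (φ 0) * W (φ 1) (φ 4) := by
  rw [edgeWeight, edgeFinset_graphH3]
  repeat rw [prod_insert (by decide)]
  simp only [prod_singleton, Sym2.lift_mk, mul_assoc]

lemma edgeWeight_graphH4 (W : ι → ι → ℝ) (hW : ∀ x y, W x y = W y x) (φ : Fin 5 → ι) :
    edgeWeight graphH4 W hW φ = W (φ 0) (φ 1) * W (φ 0) (φ 2) * W (φ 1) (φ 2) * W (φ 1) (φ 3)
      * W (φ 2) (φ 3) * W (φ 0) (φ 4) * W (φ 4) (φ 3) := by
  rw [edgeWeight, edgeFinset_graphH4]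
  repeat rw [prod_insert (by decide)]
  simp only [prod_singleton, Sym2.lift_mk, mul_assoc]

/-- A point of a fifth power as a nested tuple. -/
def finFiveEquiv (ι : Type*) : (Fin 5 → ι) ≃ ι × ι × ι × ι × ι where
  toFun φ := (φ 0, φ 1, φ 2, φ 3, φ 4)
  invFun p := ![p.1, p.2.1, p.2.2.1, p.2.2.2.1, p.2.2.2.2]
  left_inv φ := by ext i; fin_cases i <;> rfl
  right_inv _ := rfl

/-- The substitution `W = (1 + U) / 2`. -/
lemma exists_eq_half_one_add {W : ι → ι → ℝ} (hW : ∀ x y, W x y = W y x)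
    (h0 : ∀ x y, 0 ≤ W x y) (h1 : ∀ x y, W x y ≤ 1) :
    ∃ U : ι → ι → ℝ, (∀ x y, U x y = U y x) ∧ (∀ x y, |U x y| ≤ 1) ∧
      (∀ x y, W x y = (1 + U x y) / 2) ∧ ∀ x y, 1 - W x y = (1 + (-U) x y) / 2 :=
  ⟨fun x y => 2 * W x y - 1, fun x y => by simp only [hW],
    fun x y => abs_le.2 ⟨by linarith [h0 x y], by linarith [h1 x y]⟩, fun x y => by ring,
    fun x y => by simp only [Pi.neg_apply]; ring⟩

variable [Fintype ι]

/-- Averaging over five vertices may be done one vertex at a time, in any order. -/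
lemma expect_fin_five (σ : Equiv.Perm (Fin 5)) (F : ι → ι → ι → ι → ι → ℝ) :
    𝔼 φ : Fin 5 → ι, F (φ (σ 0)) (φ (σ 1)) (φ (σ 2)) (φ (σ 3)) (φ (σ 4))
      = 𝔼 a, 𝔼 b, 𝔼 c, 𝔼 d, 𝔼 e, F a b c d e := by
  refine (Fintype.expect_equiv ((Equiv.arrowCongr σ.symm (Equiv.refl ι)).trans (finFiveEquiv ι)) _
    (fun p : ι × ι × ι × ι × ι => F p.1 p.2.1 p.2.2.1 p.2.2.2.1 p.2.2.2.2) fun φ => rfl).trans ?_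
  simp only [← univ_product_univ, expect_product]

variable {U : ι → ι → ℝ}

lemma normDegree_neg (a : ι) : normDegree (-U) a = -normDegree U a := by
  simp only [normDegree, Pi.neg_apply, expect_neg_distrib]

lemma normCodegree_neg (a b : ι) : normCodegree (-U) a b = normCodegree U a b := by
  simp only [normCodegree, Pi.neg_apply, neg_mul_neg]

lemma walkTwo_neg (a : ι) : walkTwo (-U) a = walkTwo U a := by
  simp only [walkTwo, normDegree_neg, Pi.neg_apply, neg_mul_neg]

lemma pathThree_neg (a b : ι) : pathThree (-U) a b = -pathThree U a b := by
  simp only [pathThree, normCodegree_neg, Pi.neg_apply, neg_mul, expect_neg_distrib]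

lemma tripleCodegree_neg (a b c : ι) : tripleCodegree (-U) a b c = -tripleCodegree U a b c := by
  simp only [tripleCodegree, Pi.neg_apply, neg_mul, mul_neg, neg_neg, expect_neg_distrib]

/-- The codegree of `W = (1 + U) / 2` in terms of `U`. -/
lemma expect_codegree_half [Nonempty ι] (hU : ∀ x y, U x y = U y x) (a b : ι) :
    𝔼 z, ((1 + U a z) / 2) * ((1 + U z b) / 2)
      = (1 + normDegree U a + normDegree U b + normCodegree U a b) / 4 := by
  calc _ = 𝔼 z, (1 / 4 * 1 + 1 / 4 * U a z + 1 / 4 * U b z + 1 / 4 * (U a z * U b z)) :=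
        expect_congr rfl fun z _ => by rw [hU z b]; ring
    _ = _ := by
      simp only [expect_add_distrib, ← mul_expect, Fintype.expect_const]
      simp only [normDegree, normCodegree]; ring

/-- The density of walks with three edges in `W = (1 + U) / 2` in terms of `U`. -/
lemma expect_path_half [Nonempty ι] (hU : ∀ x y, U x y = U y x) (a b : ι) :
    𝔼 u, ((1 + U a u) / 2) * 𝔼 v, ((1 + U u v) / 2) * ((1 + U v b) / 2)
      = (1 + walkTwo U a + walkTwo U b + normDegree U a * normDegree U b
        + (normDegree U a + normDegree U b + (𝔼 z, normDegree U z) + pathThree U a b)) / 8 := by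
  have hK : 𝔼 u, normCodegree U u b = walkTwo U b := by
    simp only [normCodegree_comm _ b, expect_normCodegree hU]
  calc _ = 𝔼 u, (1 / 8 * ((1 + normDegree U b) * 1) + 1 / 8 * normDegree U u
            + 1 / 8 * normCodegree U u b
            + 1 / 8 * ((1 + normDegree U b) * U a u)
            + 1 / 8 * (U a u * normDegree U u) + 1 / 8 * (U a u * normCodegree U u b)) :=
        expect_congr rfl fun z _ => by rw [expect_codegree_half hU]; ring
    _ = _ := by
      simp only [expect_add_distrib, ← mul_expect, Fintype.expect_const, hK]
      simp only [walkTwo, pathThree, expect_eq_normDegree]; ring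

/-- The triple codegree of `W = (1 + U) / 2` in terms of `U`. -/
lemma expect_triple_half [Nonempty ι] (U : ι → ι → ℝ) (a b c : ι) :
    𝔼 z, ((1 + U a z) / 2) * ((1 + U b z) / 2) * ((1 + U c z) / 2)
      = (1 + normCodegree U a b + normCodegree U a c + normCodegree U b c
        + (normDegree U a + normDegree U b + normDegree U c + tripleCodegree U a b c)) / 8 := by
  calc _ = 𝔼 z, (1 / 8 * 1 + 1 / 8 * U a z + 1 / 8 * U b z + 1 / 8 * U c z
            + 1 / 8 * (U a z * U b z) + 1 / 8 * (U a z * U c z) + 1 / 8 * (U b z * U c z)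
            + 1 / 8 * (U a z * U b z * U c z)) :=
        expect_congr rfl fun z _ => by ring
    _ = _ := by
      simp only [expect_add_distrib, ← mul_expect, Fintype.expect_const]
      simp only [normDegree, normCodegree, tripleCodegree]; ring

lemma expect_edgeWeight_graphH3 [Nonempty ι] {W : ι → ι → ℝ} (hW : ∀ x y, W x y = W y x)
    (hU : ∀ x y, U x y = U y x) (hWU : ∀ x y, W x y = (1 + U x y) / 2) :
    𝔼 φ, edgeWeight graphH3 W hW φ
      = 𝔼 a, 𝔼 b, 1 / 64 * ((1 + U a b)
        * (1 + normDegree U a + normDegree U b + normCodegree U a b)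
        * (1 + walkTwo U a + walkTwo U b + normDegree U a * normDegree U b
          + (normDegree U a + normDegree U b + (𝔼 z, normDegree U z) + pathThree U a b))) := by
  simp only [edgeWeight_graphH3]
  -- the end points `1`, `4` of the chord come before the other vertices
  refine (expect_fin_five ⟨![1, 4, 0, 2, 3], ![2, 0, 3, 4, 1], by decide, by decide⟩
    fun a b z u v => W z a * W a u * W u v * W v b * W b z * W a b).trans ?_
  refine expect_congr rfl fun a _ => expect_congr rfl fun b _ => ?_
  suffices h : 𝔼 z, 𝔼 u, 𝔼 v, W z a * W a u * W u v * W v b * W b z * W a b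
      = W a b * (𝔼 z, W a z * W z b) * 𝔼 u, W a u * 𝔼 v, W u v * W v b by
    rw [h]
    simp only [hWU]
    rw [expect_codegree_half hU, expect_path_half hU]
    ring
  rw [mul_assoc, Finset.expect_mul_expect, mul_expect]
  refine expect_congr rfl fun z _ => ?_
  simp only [mul_expect]
  refine expect_congr rfl fun u _ => expect_congr rfl fun v _ => ?_
  rw [hW z a, hW b z]; ring

lemma expect_edgeWeight_graphH4 [Nonempty ι] {W : ι → ι → ℝ} (hW : ∀ x y, W x y = W y x)
    (hWU : ∀ x y, W x y = (1 + U x y) / 2) :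
    𝔼 φ, edgeWeight graphH4 W hW φ
      = 𝔼 a, 𝔼 b, 𝔼 c, 1 / 128 * ((1 + U a b)
        * (1 + normCodegree U a b + normCodegree U a c + normCodegree U b c
          + (normDegree U a + normDegree U b + normDegree U c + tripleCodegree U a b c)) ^ 2) := by
  simp only [edgeWeight_graphH4]
  -- `graphH4` is complete bipartite between `{1, 2, 4}` and `{0, 3}`, plus the edge `12`
  refine (expect_fin_five ⟨![1, 2, 4, 0, 3], ![3, 0, 1, 4, 2], by decide, by decide⟩
    fun a b c z w => W z a * W z b * W a b * W a w * W b w * W z c * W c w).trans ?_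
  refine expect_congr rfl fun a _ => expect_congr rfl fun b _ => expect_congr rfl fun c _ => ?_
  suffices h : 𝔼 z, 𝔼 w, W z a * W z b * W a b * W a w * W b w * W z c * W c w
      = W a b * (𝔼 z, W a z * W b z * W c z) ^ 2 by
    rw [h]
    simp only [hWU]
    rw [expect_triple_half]
    ring
  rw [sq, Finset.expect_mul_expect, mul_expect]
  refine expect_congr rfl fun z _ => ?_
  rw [mul_expect]
  refine expect_congr rfl fun w _ => ?_
  rw [hW z a, hW z b, hW z c]; ring

theorem finitelyCommon_graphH3 : FinitelyCommon graphH3 := by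
  intro n _ W hW h0 h1
  obtain ⟨U, hU, hU1, hWU, hWU'⟩ := exists_eq_half_one_add hW h0 h1
  have hU' : ∀ x y, (-U) x y = (-U) y x := fun x y => by simp only [Pi.neg_apply, hU]
  have hcore := house_core hU hU1
  have hcard : #graphH3.edgeFinset = 6 := by rw [edgeFinset_graphH3]; decide
  rw [hcard, expect_add_distrib, expect_edgeWeight_graphH3 hW hU hWU,
    expect_edgeWeight_graphH3 _ hU' hWU', ← expect_add_distrib]
  simp only [← expect_add_distrib, normDegree_neg, normCodegree_neg, walkTwo_neg, pathThree_neg,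
    expect_neg_distrib, Pi.neg_apply]
  calc (2 : ℝ) ^ (1 - ((6 : ℕ) : ℤ)) = 1 / 32 * 1 := by norm_num
    _ ≤ 1 / 32 * _ := mul_le_mul_of_nonneg_left hcore (by norm_num)
    _ = _ := by
      simp only [mul_expect (s := univ) (a := (1 / 32 : ℝ))]
      exact expect_congr rfl fun a _ => expect_congr rfl fun b _ => by ring

theorem finitelyCommon_graphH4 : FinitelyCommon graphH4 := by
  intro n _ W hW h0 h1
  obtain ⟨U, hU, hU1, hWU, hWU'⟩ := exists_eq_half_one_add hW h0 h1
  have hcore := subdividedK4_core hU hU1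
  have hcard : #graphH4.edgeFinset = 7 := by rw [edgeFinset_graphH4]; decide
  rw [hcard, expect_add_distrib, expect_edgeWeight_graphH4 hW hWU,
    expect_edgeWeight_graphH4 _ hWU', ← expect_add_distrib]
  simp only [← expect_add_distrib, normDegree_neg, normCodegree_neg, tripleCodegree_neg,
    Pi.neg_apply]
  calc (2 : ℝ) ^ (1 - ((7 : ℕ) : ℤ)) = 1 / 64 * 1 := by norm_num
    _ ≤ 1 / 64 * _ := mul_le_mul_of_nonneg_left hcore (by norm_num)
    _ = _ := by
      simp only [mul_expect (s := univ) (a := (1 / 64 : ℝ))]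
      exact expect_congr rfl fun a _ => expect_congr rfl fun b _ =>
        expect_congr rfl fun c _ => by ring

end

end CommonGraph

theorem mainTheorem8 :
    (graphH3.IsCommon ∧ ∀ W : Graphon, (2 : ℝ) ^ (-5 : ℤ) ≤ W.monoDensity graphH3) ∧
    (graphH4.IsCommon ∧ ∀ W : Graphon, (2 : ℝ) ^ (-6 : ℤ) ≤ W.monoDensity graphH4) := by
  have h3 : graphH3.edgeFinset.card = 6 := by rw [CommonGraph.edgeFinset_graphH3]; decide
  have h4 : graphH4.edgeFinset.card = 7 := by rw [CommonGraph.edgeFinset_graphH4]; decide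
  refine ⟨⟨CommonGraph.finitelyCommon_graphH3.isCommon, fun W => ?_⟩,
    CommonGraph.finitelyCommon_graphH4.isCommon, fun W => ?_⟩
  · have := CommonGraph.finitelyCommon_graphH3.le_monoDensity W
    rw [h3] at this
    norm_num at this ⊢
    exact this
  · have := CommonGraph.finitelyCommon_graphH4.le_monoDensity W
    rw [h4] at this
    norm_num at this ⊢
    exact this
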